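/- For countable discrete groups $\Lambda,\Gamma$ let $[\Lambda,\Gamma]=\{f:\Lambda\to\Gamma \mid f(e)=e\}$, with the topology of pointwise convergence ($\Gamma$ discrete), its Borel $\sigma$-algebra, and the $\Lambda$-action $(\lambda\cdot f)(x)=f(x\lambda)f(\lambda)^{-1}$. The group $\Lambda$ is called a random subgroup of $\Gamma$ if there is a $\Lambda$-invariant Borel probability measure on $[\Lambda,\Gamma]$ that is supported on the injective maps (i.e. almost every $f$ is injective). The graph product over a simple graph $\Theta$ of groups $(A_v)_{v\in V}$ indexed by its vertex set $V$ is the quotient of the free product of the $A_v$ by the normal subgroup generated by all commutators $[a,b]$ with $a\in A_u$, $b\in A_v$ and $u,v$ adjacent in $\Theta$. Let $\Theta$ be a finite simple graph (not necessarily irreducible, i.e. possibly a join of two nonempty subgraphs) with vertex set $V$. Let $H$ and $G$ be the graph products over $\Theta$ of nontrivial finitely generated groups $(H_v)_{v\in V}$ and $(G_v)_{v\in V}$, respectively. Suppose that for each $v\in V$, $H_v$ is a random subgroup of $G_v$. Then $H$ is a random subgroup of $G$. -/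

import Mathlib

open MeasureTheory

/-- The graph product of the groups `A v` over the simple graph `Θ`: the free product of the vertex
groups modulo the commutators of elements of vertex groups at adjacent vertices. -/
def GraphProduct {V : Type*} (Θ : SimpleGraph V) (A : V → Type*) [∀ v, Group (A v)] : Type _ :=
  Monoid.CoprodI A ⧸ Subgroup.normalClosure
    {g : Monoid.CoprodI A | ∃ (u v : V) (a : A u) (b : A v), Θ.Adj u v ∧
      g = Monoid.CoprodI.of a * Monoid.CoprodI.of b * (Monoid.CoprodI.of a)⁻¹ *
        (Monoid.CoprodI.of b)⁻¹}

instance GraphProduct.instGroup {V : Type*} (Θ : SimpleGraph V) (A : V → Type*)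
    [∀ v, Group (A v)] : Group (GraphProduct Θ A) :=
  inferInstanceAs (Group (Monoid.CoprodI A ⧸ Subgroup.normalClosure _))

/-- The space `[Λ, Γ]` of all maps `f : Λ → Γ` with `f 1 = 1`. -/
def PointedMaps (Λ Γ : Type*) [Group Λ] [Group Γ] : Type _ := {f : Λ → Γ // f 1 = 1}

namespace PointedMaps

instance instFunLike (Λ Γ : Type*) [Group Λ] [Group Γ] : FunLike (PointedMaps Λ Γ) Λ Γ where
  coe f := f.1
  coe_injective _ _ h := Subtype.ext h

/-- The topology of pointwise convergence, where `Γ` is discrete. -/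
instance instTopologicalSpace (Λ Γ : Type*) [Group Λ] [Group Γ] :
    TopologicalSpace (PointedMaps Λ Γ) :=
  TopologicalSpace.induced (fun f (l : Λ) => f l)
    (@Pi.topologicalSpace Λ (fun _ => Γ) (fun _ => ⊥))

/-- The σ-algebra generated by the evaluation maps, where `Γ` carries the discrete σ-algebra.
For countable groups it is the Borel σ-algebra, see `PointedMaps.borelSpace`. -/
instance instMeasurableSpace (Λ Γ : Type*) [Group Λ] [Group Γ] :
    MeasurableSpace (PointedMaps Λ Γ) :=
  MeasurableSpace.comap (fun f (l : Λ) => f l)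
    (@MeasurableSpace.pi Λ (fun _ => Γ) (fun _ => ⊤))

theorem borelSpace (Λ Γ : Type*) [Group Λ] [Group Γ] [Countable Λ] [Countable Γ] :
    BorelSpace (PointedMaps Λ Γ) := by
  let : TopologicalSpace Γ := ⊥
  have : DiscreteTopology Γ := ⟨rfl⟩
  let : MeasurableSpace Γ := ⊤
  have : BorelSpace Γ := ⟨borel_eq_top_of_discrete.symm⟩
  have h : (MeasurableSpace.pi : MeasurableSpace (Λ → Γ)) = borel (Λ → Γ) :=
    BorelSpace.measurable_eq
  constructor
  change MeasurableSpace.comap _ MeasurableSpace.pi = _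
  rw [h]
  exact borel_comap.symm

/-- The action of `Λ` on `[Λ, Γ]` given by `(l • f) x = f (x * l) * (f l)⁻¹`. -/
instance instMulAction (Λ Γ : Type*) [Group Λ] [Group Γ] : MulAction Λ (PointedMaps Λ Γ) where
  smul l f := ⟨fun x => f (x * l) * (f l)⁻¹, by simp⟩
  one_smul f := by
    apply Subtype.ext
    funext x
    change f (x * 1) * (f 1)⁻¹ = f x
    have h : f 1 = 1 := f.2
    simp [h]
  mul_smul l m f := by
    apply Subtype.ext
    funext x
    change f (x * (l * m)) * (f (l * m))⁻¹ =
      f (x * l * m) * (f m)⁻¹ * (f (l * m) * (f m)⁻¹)⁻¹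
    simp [mul_assoc]

end PointedMaps

/-- A randomorphism from `Λ` to `Γ`: a `Λ`-invariant probability measure on `[Λ, Γ]`. -/
structure IsRandomorphism {Λ Γ : Type*} [Group Λ] [Group Γ]
    (μ : Measure (PointedMaps Λ Γ)) : Prop where
  isProbabilityMeasure : IsProbabilityMeasure μ
  invariant : SMulInvariantMeasure Λ (PointedMaps Λ Γ) μ

/-- A randembedding is a randomorphism that is supported on the injective maps. -/
structure IsRandembedding {Λ Γ : Type*} [Group Λ] [Group Γ]
    (μ : Measure (PointedMaps Λ Γ)) : Prop extends IsRandomorphism μ where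
  injective : ∀ᵐ f : PointedMaps Λ Γ ∂μ, Function.Injective f

/-- `Λ` is a random subgroup of `Γ` if it admits a randembedding into `Γ`. -/
def IsRandomSubgroup (Λ Γ : Type*) [Group Λ] [Group Γ] : Prop :=
  ∃ μ : Measure (PointedMaps Λ Γ), IsRandembedding μ

/-! Let each `H v` act on its own coordinate of the product of the spaces `[H v, G v]`. Evaluation
at a vertex is a cocycle for this action, and at adjacent vertices both the actions and the cocycle
values commute, so everything extends to a cocycle of `GraphProduct Θ H` with values in
`GraphProduct Θ G`. The randembedding is the pushforward of the product measure under
`toPointedMaps`: it is invariant by `smul_toPointedMaps` and `measurePreserving_base`. When all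
coordinates are injective, the cocycle turns a reduced word into a reduced word with the same
vertices (`exists_isReduced_cocycle`). The normal form theorem `eq_nil_of_wordProd_eq_one`, proved
by an action on heaps of pieces, then gives injectivity. -/

theorem Group.countable_of_fg (Γ : Type*) [Group Γ] [Group.FG Γ] : Countable Γ := by
  obtain ⟨S, hS, φ, hφ⟩ := Group.fg_iff_exists_freeGroup_hom_surjective.1 ‹Group.FG Γ›
  have : Finite S := hS
  have : Countable (FreeGroup S) :=
    Function.Surjective.countable (f := fun l : List (S × Bool) => FreeGroup.mk l)
      Quot.mk_surjective
  exact hφ.countable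

namespace GraphProduct

/-! ### Words and reduced words in graph products -/

section Words

variable {V : Type*} {Θ : SimpleGraph V} {A : V → Type*} [∀ v, Group (A v)]

/-- The canonical homomorphism from a vertex group to the graph product. -/
def of (Θ : SimpleGraph V) {A : V → Type*} [∀ v, Group (A v)] (v : V) :
    A v →* GraphProduct Θ A :=
  (QuotientGroup.mk' _).comp Monoid.CoprodI.of

theorem commute_of {u v : V} (huv : Θ.Adj u v) (a : A u) (b : A v) :
    Commute (of Θ u a) (of Θ v b) := by
  have h : (QuotientGroup.mk (Monoid.CoprodI.of a * Monoid.CoprodI.of b *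
      (Monoid.CoprodI.of a)⁻¹ * (Monoid.CoprodI.of b)⁻¹) : GraphProduct Θ A) =
      (1 : GraphProduct Θ A) :=
    (QuotientGroup.eq_one_iff _).2 (Subgroup.subset_normalClosure ⟨u, v, a, b, huv, rfl⟩)
  have h' : of Θ u a * of Θ v b * (of Θ u a)⁻¹ * (of Θ v b)⁻¹ = 1 := h
  exact mul_inv_eq_iff_eq_mul.1 (mul_inv_eq_one.1 h')

/-- The universal property of the graph product. -/
def lift {K : Type*} [Group K] (φ : ∀ v, A v →* K)
    (hφ : ∀ u v, Θ.Adj u v → ∀ (a : A u) (b : A v), Commute (φ u a) (φ v b)) :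
    GraphProduct Θ A →* K :=
  QuotientGroup.lift _ (Monoid.CoprodI.lift φ) (by
    refine Subgroup.normalClosure_le_normal (N := (Monoid.CoprodI.lift φ).ker) ?_
    rintro g ⟨u, v, a, b, huv, rfl⟩
    simp [MonoidHom.mem_ker, (hφ u v huv a b).eq])

@[simp]
theorem lift_of {K : Type*} [Group K] (φ : ∀ v, A v →* K)
    (hφ : ∀ u v, Θ.Adj u v → ∀ (a : A u) (b : A v), Commute (φ u a) (φ v b))
    (v : V) (a : A v) : lift φ hφ (of Θ v a) = φ v a :=
  Monoid.CoprodI.lift_of φ a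

/-- The element of the graph product spelled by a word in the vertex groups. -/
def wordProd (Θ : SimpleGraph V) (w : List (Σ v, A v)) : GraphProduct Θ A :=
  (w.map fun p => of Θ p.1 p.2).prod

@[simp]
theorem wordProd_nil : wordProd Θ ([] : List (Σ v, A v)) = 1 := rfl

@[simp]
theorem wordProd_cons (p : Σ v, A v) (w : List (Σ v, A v)) :
    wordProd Θ (p :: w) = of Θ p.1 p.2 * wordProd Θ w := by
  simp [wordProd]

theorem wordProd_append (w₁ w₂ : List (Σ v, A v)) :
    wordProd Θ (w₁ ++ w₂) = wordProd Θ w₁ * wordProd Θ w₂ := by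
  simp [wordProd]

theorem wordProd_surjective :
    Function.Surjective (wordProd Θ : List (Σ v, A v) → GraphProduct Θ A) := by
  intro g
  obtain ⟨g, rfl⟩ := QuotientGroup.mk_surjective g
  induction g using Monoid.CoprodI.induction_on with
  | one => exact ⟨[], rfl⟩
  | of v a => exact ⟨[⟨v, a⟩], by rw [wordProd_cons, wordProd_nil, mul_one]; rfl⟩
  | mul x y hx hy =>
    obtain ⟨w₁, h₁⟩ := hx
    obtain ⟨w₂, h₂⟩ := hy
    exact ⟨w₁ ++ w₂, by rw [wordProd_append, h₁, h₂]; rfl⟩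

instance [Countable V] [∀ v, Countable (A v)] : Countable (GraphProduct Θ A) :=
  (wordProd_surjective (Θ := Θ) (A := A)).countable

/-- The vertex `v` occurs in the list, and everything before its first occurrence is adjacent
to it. -/
def Exposed (Θ : SimpleGraph V) (v : V) : List V → Prop
  | [] => False
  | u :: l => u = v ∨ (Θ.Adj u v ∧ Exposed Θ v l)

/-- No two occurrences of a vertex can be brought together by exchanging adjacent vertices. -/
def IsReducedShape (Θ : SimpleGraph V) : List V → Prop
  | [] => True
  | v :: l => ¬ Exposed Θ v l ∧ IsReducedShape Θ l

/-- Reduced words: no trivial letters, and no two letters can be merged after shuffling. -/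
def IsReduced (Θ : SimpleGraph V) (w : List (Σ v, A v)) : Prop :=
  (∀ p ∈ w, p.2 ≠ 1) ∧ IsReducedShape Θ (w.map Sigma.fst)

theorem isReduced_cons (p : Σ v, A v) (w : List (Σ v, A v)) :
    IsReduced Θ (p :: w) ↔
      p.2 ≠ 1 ∧ ¬ Exposed Θ p.1 (w.map Sigma.fst) ∧ IsReduced Θ w := by
  simp only [IsReduced, List.forall_mem_cons, List.map_cons, IsReducedShape]
  tauto

/-- A letter can be merged into a word in which its vertex is exposed. -/
theorem exists_wordProd_eq_of_mul (v : V) (a : A v) (w : List (Σ v, A v))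
    (hw : Exposed Θ v (w.map Sigma.fst)) :
    ∃ w' : List (Σ v, A v), w'.length = w.length ∧
      wordProd Θ w' = of Θ v a * wordProd Θ w := by
  induction w with
  | nil => exact hw.elim
  | cons p w ih =>
    obtain ⟨u, b⟩ := p
    rcases hw with h | ⟨hadj, h⟩
    · obtain rfl : u = v := h
      exact ⟨⟨u, a * b⟩ :: w, rfl, by simp [mul_assoc]⟩
    · obtain ⟨w', hl, hp⟩ := ih h
      refine ⟨⟨u, b⟩ :: w', by simp [hl], ?_⟩
      rw [wordProd_cons, wordProd_cons, hp, ← mul_assoc, ← mul_assoc,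
        (commute_of hadj b a).eq]

theorem isReduced_or_exists_shorter (w : List (Σ v, A v)) :
    IsReduced Θ w ∨ ∃ w' : List (Σ v, A v), w'.length < w.length ∧
      wordProd Θ w' = wordProd Θ w := by
  induction w with
  | nil => exact Or.inl ⟨by simp, trivial⟩
  | cons p w ih =>
    by_cases hp : p.2 = 1
    · exact Or.inr ⟨w, by simp, by simp [hp]⟩
    by_cases he : Exposed Θ p.1 (w.map Sigma.fst)
    · obtain ⟨w', hl, h⟩ := exists_wordProd_eq_of_mul p.1 p.2 w he
      exact Or.inr ⟨w', by simp [hl], by simp [h]⟩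
    rcases ih with h | ⟨w', hl, h⟩
    · exact Or.inl ((isReduced_cons p w).2 ⟨hp, he, h⟩)
    · exact Or.inr ⟨p :: w', by simpa using hl, by simp [h]⟩

theorem exists_isReduced (g : GraphProduct Θ A) :
    ∃ w : List (Σ v, A v), IsReduced Θ w ∧ wordProd Θ w = g := by
  obtain ⟨w, rfl⟩ := wordProd_surjective g
  induction hn : w.length using Nat.strong_induction_on generalizing w with
  | _ n ih =>
    rcases isReduced_or_exists_shorter (Θ := Θ) w with h | ⟨w', hl, h⟩
    · exact ⟨w, h, rfl⟩
    · obtain ⟨w'', h₁, h₂⟩ := ih _ (hn ▸ hl) w' rfl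
      exact ⟨w'', h₁, h₂.trans h⟩

end Words

/-! ### Heaps of pieces and the normal form theorem -/

section Heap

/-- The height of a column of a heap of pieces: the largest index with a nontrivial entry. -/
noncomputable def columnHeight {B : Type*} [One B] (c : ℕ → B) : ℕ := sSup {n | c n ≠ 1}

theorem columnHeight_one {B : Type*} [One B] : columnHeight (1 : ℕ → B) = 0 := by
  simp [columnHeight]

variable {V : Type*} [Fintype V] (Θ : SimpleGraph V) {A : V → Type*} [∀ v, Group (A v)]

open scoped Classical in
/-- The height of the highest piece of a heap in a column that does not commute with `v` and is
different from `v`. -/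
noncomputable def obstruction (s : ∀ v, ℕ → A v) (v : V) : ℕ :=
  (Finset.univ.filter fun u => u ≠ v ∧ ¬ Θ.Adj u v).sup fun u => columnHeight (s u)

variable {Θ}

theorem columnHeight_le_obstruction (s : ∀ v, ℕ → A v) {u v : V} (huv : u ≠ v)
    (h : ¬ Θ.Adj u v) : columnHeight (s u) ≤ obstruction Θ s v := by
  classical
  exact Finset.le_sup (f := fun u => columnHeight (s u)) (by simp [huv, h])

theorem obstruction_congr {s t : ∀ v, ℕ → A v} {v : V}
    (h : ∀ u, u ≠ v → ¬ Θ.Adj u v → s u = t u) : obstruction Θ s v = obstruction Θ t v := by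
  classical
  refine Finset.sup_congr rfl fun u hu => ?_
  simp only [Finset.mem_filter, Finset.mem_univ, true_and] at hu
  rw [h u hu.1 hu.2]

variable (Θ)

open scoped Classical in
/-- Multiplying the entry of the column `v` just above all pieces that obstruct it. -/
noncomputable def push (v : V) (a : A v) (s : ∀ v, ℕ → A v) : ∀ v, ℕ → A v :=
  Function.update s v
    -- Pushes only touch slots from 1 on, so in heaps built from the empty one, height 0 means an
    -- empty column.
    (Function.update (s v) (obstruction Θ s v + 1) (a * s v (obstruction Θ s v + 1)))

variable {Θ}

theorem push_of_ne {u v : V} (h : u ≠ v) (a : A v) (s : ∀ v, ℕ → A v) :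
    push Θ v a s u = s u := by
  simp [push, h]

theorem push_same (v : V) (a : A v) (s : ∀ v, ℕ → A v) :
    push Θ v a s v =
      Function.update (s v) (obstruction Θ s v + 1) (a * s v (obstruction Θ s v + 1)) := by
  simp [push]

/-- The obstruction ignores column `v` itself, so successive pushes at `v` hit the same slot and
multiply there. -/
theorem obstruction_push_same (v : V) (a : A v) (s : ∀ v, ℕ → A v) :
    obstruction Θ (push Θ v a s) v = obstruction Θ s v :=
  obstruction_congr fun _ hu _ => push_of_ne hu a s

theorem obstruction_push_of_adj {u v : V} (h : Θ.Adj u v) (a : A u) (s : ∀ v, ℕ → A v) :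
    obstruction Θ (push Θ u a s) v = obstruction Θ s v :=
  obstruction_congr fun w _ hw => push_of_ne (by rintro rfl; exact hw h) a s

/-- The action of a vertex group on heaps of pieces. -/
noncomputable def pushHom (Θ : SimpleGraph V) (v : V) :
    A v →* Equiv.Perm (∀ v, ℕ → A v) :=
  MonoidHom.toHomPerm
    { toFun := push Θ v
      map_one' := by
        funext s
        change push Θ v 1 s = s
        simp [push]
      map_mul' := fun a b => by
        funext s
        change push Θ v (a * b) s = push Θ v a (push Θ v b s)
        funext u
        by_cases hu : u = v
        · subst hu
          rw [push_same, push_same, obstruction_push_same, push_same]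
          simp [mul_assoc]
        · simp only [push_of_ne hu] }

/-- The action of the graph product on heaps of pieces. -/
noncomputable def heapHom (Θ : SimpleGraph V) (A : V → Type*) [∀ v, Group (A v)] :
    GraphProduct Θ A →* Equiv.Perm (∀ v, ℕ → A v) :=
  lift (pushHom Θ) fun u v huv a b => by
    refine Equiv.ext fun s => ?_
    change push Θ u a (push Θ v b s) = push Θ v b (push Θ u a s)
    have hne : u ≠ v := huv.ne
    funext w
    by_cases hu : w = u
    · subst hu
      rw [push_same, obstruction_push_of_adj huv.symm, push_of_ne hne, push_of_ne hne, push_same]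
    · by_cases hv : w = v
      · subst hv
        rw [push_of_ne hu, push_same, push_same, obstruction_push_of_adj huv, push_of_ne hu]
      · simp only [push_of_ne hu, push_of_ne hv]

theorem heapHom_of (v : V) (a : A v) (s : ∀ v, ℕ → A v) :
    heapHom Θ A (of Θ v a) s = push Θ v a s :=
  DFunLike.congr_fun (lift_of (pushHom Θ) _ v a) s

/-- The slot just above the obstruction is still empty, so `a` lands there unmerged. Boundedness
excludes the junk value of `sSup`. -/
theorem columnHeight_push {v : V} {a : A v} (ha : a ≠ 1) {s : ∀ v, ℕ → A v}
    (hb : BddAbove {n | s v n ≠ 1}) (hs : columnHeight (s v) ≤ obstruction Θ s v) :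
    IsGreatest {n | push Θ v a s v n ≠ 1} (obstruction Θ s v + 1) := by
  have h : ∀ n, obstruction Θ s v < n → s v n = 1 := fun n hn => by
    by_contra hne
    exact absurd (le_csSup hb hne) (not_le.2 (hs.trans_lt hn))
  rw [push_same]
  refine ⟨by simp [h _ (Nat.lt_succ_self _), ha], fun n hn => ?_⟩
  by_contra hlt
  rw [not_le] at hlt
  exact hn (by rw [Function.update_of_ne hlt.ne', h n (by omega)])

/-- In the heap of a reduced word, a vertex that is not exposed is obstructed. -/
theorem heap_of_isReduced (w : List (Σ v, A v)) (hw : IsReduced Θ w) :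
    (∀ v, BddAbove {n | heapHom Θ A (wordProd Θ w) 1 v n ≠ 1}) ∧
    ∀ v, ¬ Exposed Θ v (w.map Sigma.fst) →
      columnHeight (heapHom Θ A (wordProd Θ w) 1 v) ≤
        obstruction Θ (heapHom Θ A (wordProd Θ w) 1) v := by
  induction w with
  | nil =>
    refine ⟨fun v => by simp, fun v _ => ?_⟩
    simp [columnHeight_one]
  | cons p w ih =>
    obtain ⟨v, a⟩ := p
    obtain ⟨ha, he, hw⟩ := (isReduced_cons _ _).1 hw
    obtain ⟨hb, hh⟩ := ih hw
    rw [wordProd_cons, map_mul, Equiv.Perm.mul_apply, heapHom_of]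
    generalize heapHom Θ A (wordProd Θ w) 1 = s at hb hh ⊢
    have hg := columnHeight_push ha (hb v) (hh v he)
    refine ⟨fun u => ?_, fun u hu => ?_⟩
    · by_cases huv : u = v
      · subst huv
        exact ⟨_, hg.2⟩
      · simpa only [push_of_ne huv] using hb u
    · simp only [List.map_cons, Exposed, not_or, not_and] at hu
      have huv : u ≠ v := Ne.symm hu.1
      rw [push_of_ne huv]
      by_cases hadj : Θ.Adj v u
      · rw [obstruction_push_of_adj hadj]
        exact hh u (hu.2 hadj)
      -- The new piece at `v` lies above column `u` and now obstructs it.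
      · have h₁ := columnHeight_le_obstruction s huv fun h => hadj h.symm
        have h₂ := columnHeight_le_obstruction (push Θ v a s) hu.1 hadj
        rw [columnHeight, hg.csSup_eq] at h₂
        exact h₁.trans ((Nat.le_succ _).trans h₂)

/-- The normal form theorem for graph products: a nonempty reduced word is nontrivial. -/
theorem eq_nil_of_wordProd_eq_one (w : List (Σ v, A v)) (hw : IsReduced Θ w)
    (h : wordProd Θ w = 1) : w = [] := by
  cases w with
  | nil => rfl
  | cons p w =>
    exfalso
    obtain ⟨ha, he, hw'⟩ := (isReduced_cons _ _).1 hw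
    obtain ⟨hb, hh⟩ := heap_of_isReduced w hw'
    have hg := (columnHeight_push ha (hb p.1) (hh p.1 he)).1
    rw [← heapHom_of, ← Equiv.Perm.mul_apply, ← map_mul, ← wordProd_cons, h] at hg
    simp at hg

end Heap

/-! ### The skew product and its cocycle -/

section Cocycle

open PointedMaps

variable {V : Type*} {Θ : SimpleGraph V} {H G : V → Type*} [∀ v, Group (H v)]
  [∀ v, Group (G v)]

open scoped Classical in
/-- The skew product transformation defined by an element of a vertex group. -/
noncomputable def skew (Θ : SimpleGraph V) (v : V) (a : H v)
    (p : (∀ v, PointedMaps (H v) (G v)) × GraphProduct Θ G) :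
    (∀ v, PointedMaps (H v) (G v)) × GraphProduct Θ G :=
  (Function.update p.1 v (a • p.1 v), of Θ v (p.1 v a) * p.2)

/-- The skew product action of a vertex group. -/
noncomputable def skewVertexHom (Θ : SimpleGraph V) (H G : V → Type*) [∀ v, Group (H v)]
    [∀ v, Group (G v)] (v : V) :
    H v →* Equiv.Perm ((∀ v, PointedMaps (H v) (G v)) × GraphProduct Θ G) :=
  MonoidHom.toHomPerm
    { toFun := skew Θ v
      map_one' := by
        funext p
        have h : p.1 v 1 = 1 := (p.1 v).2
        change skew Θ v 1 p = p
        simp [skew, h]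
      map_mul' := fun a b => by
        funext p
        change skew Θ v (a * b) p = skew Θ v a (skew Θ v b p)
        have h : (b • p.1 v) a * p.1 v b = p.1 v (a * b) := by
          change p.1 v (a * b) * (p.1 v b)⁻¹ * p.1 v b = _
          simp
        simp [skew, mul_smul, ← h, mul_assoc] }

/-- The skew product action of the graph product. -/
noncomputable def skewHom (Θ : SimpleGraph V) (H G : V → Type*) [∀ v, Group (H v)]
    [∀ v, Group (G v)] : GraphProduct Θ H →*
      Equiv.Perm ((∀ v, PointedMaps (H v) (G v)) × GraphProduct Θ G) :=
  lift (skewVertexHom Θ H G) fun u v huv a b => by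
    refine Equiv.ext fun p => ?_
    classical
    change skew Θ u a (skew Θ v b p) = skew Θ v b (skew Θ u a p)
    have hne : u ≠ v := huv.ne
    refine Prod.ext ?_ ?_
    · simp only [skew, Function.update_of_ne hne, Function.update_of_ne hne.symm]
      exact Function.update_comm hne.symm _ _ _
    · simp only [skew, Function.update_of_ne hne, Function.update_of_ne hne.symm, ← mul_assoc,
        (commute_of huv _ _).eq]

/-- The action of the graph product on the product of the spaces of the vertices. -/
noncomputable def base (h : GraphProduct Θ H) (x : ∀ v, PointedMaps (H v) (G v)) :
    ∀ v, PointedMaps (H v) (G v) :=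
  (skewHom Θ H G h (x, 1)).1

/-- The cocycle that extends the cocycles of the vertices. -/
noncomputable def cocycle (h : GraphProduct Θ H) (x : ∀ v, PointedMaps (H v) (G v)) :
    GraphProduct Θ G :=
  (skewHom Θ H G h (x, 1)).2

theorem skewHom_of (v : V) (a : H v)
    (p : (∀ v, PointedMaps (H v) (G v)) × GraphProduct Θ G) :
    skewHom Θ H G (of Θ v a) p = skew Θ v a p :=
  DFunLike.congr_fun (lift_of (skewVertexHom Θ H G) _ v a) p

/-- The skew action commutes with right translation of the group coordinate, so the cocycle identity
can be read off from the action law. -/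
theorem skewHom_apply (h : GraphProduct Θ H) (x : ∀ v, PointedMaps (H v) (G v))
    (g : GraphProduct Θ G) : skewHom Θ H G h (x, g) = (base h x, cocycle h x * g) := by
  obtain ⟨w, rfl⟩ := wordProd_surjective h
  unfold base cocycle
  induction w with
  | nil => simp
  | cons p w ih =>
    simp only [wordProd_cons, map_mul, Equiv.Perm.mul_apply, skewHom_of]
    rw [ih]
    simp [skew, mul_assoc]

theorem base_one (x : ∀ v, PointedMaps (H v) (G v)) :
    base (1 : GraphProduct Θ H) x = x := by
  simp [base]

theorem cocycle_one (x : ∀ v, PointedMaps (H v) (G v)) :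
    cocycle (1 : GraphProduct Θ H) x = 1 := by
  simp [cocycle]

theorem base_mul (h k : GraphProduct Θ H) (x : ∀ v, PointedMaps (H v) (G v)) :
    base (h * k) x = base h (base k x) := by
  conv_lhs => rw [base, map_mul, Equiv.Perm.mul_apply, skewHom_apply, skewHom_apply]

theorem cocycle_mul (h k : GraphProduct Θ H) (x : ∀ v, PointedMaps (H v) (G v)) :
    cocycle (h * k) x = cocycle h (base k x) * cocycle k x := by
  conv_lhs => rw [cocycle, map_mul, Equiv.Perm.mul_apply, skewHom_apply, skewHom_apply]
  simp

open scoped Classical in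
theorem base_of (v : V) (a : H v) (x : ∀ v, PointedMaps (H v) (G v)) :
    base (of Θ v a) x = Function.update x v (a • x v) := by
  rw [base, skewHom_of, skew]

theorem cocycle_of (v : V) (a : H v) (x : ∀ v, PointedMaps (H v) (G v)) :
    cocycle (of Θ v a) x = of Θ v (x v a) := by
  rw [cocycle, skewHom_of, skew, mul_one]

/-- The pointed map of the cocycle at a point. -/
noncomputable def toPointedMaps (Θ : SimpleGraph V) (x : ∀ v, PointedMaps (H v) (G v)) :
    PointedMaps (GraphProduct Θ H) (GraphProduct Θ G) :=
  ⟨fun h => cocycle h x, cocycle_one x⟩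

theorem toPointedMaps_apply (x : ∀ v, PointedMaps (H v) (G v)) (h : GraphProduct Θ H) :
    toPointedMaps Θ x h = cocycle h x := rfl

theorem smul_toPointedMaps (h : GraphProduct Θ H) (x : ∀ v, PointedMaps (H v) (G v)) :
    h • toPointedMaps Θ x = toPointedMaps Θ (base h x) := by
  apply DFunLike.ext
  intro k
  change cocycle (k * h) x * (cocycle h x)⁻¹ = cocycle k (base h x)
  rw [cocycle_mul, mul_inv_cancel_right]

theorem injective_smul {Λ Γ : Type*} [Group Λ] [Group Γ] (l : Λ) {f : PointedMaps Λ Γ}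
    (hf : Function.Injective f) : Function.Injective (l • f) := by
  intro x y hxy
  change f (x * l) * (f l)⁻¹ = f (y * l) * (f l)⁻¹ at hxy
  exact mul_right_cancel (hf (mul_right_cancel hxy))

theorem injective_base (h : GraphProduct Θ H) {x : ∀ v, PointedMaps (H v) (G v)}
    (hx : ∀ v, Function.Injective (x v)) (v : V) : Function.Injective (base h x v) := by
  classical
  obtain ⟨w, rfl⟩ := wordProd_surjective h
  induction w generalizing v with
  | nil => simpa [base_one] using hx v
  | cons p w ih =>
    rw [wordProd_cons, base_mul, base_of]
    by_cases hv : v = p.1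
    · subst hv
      simpa using injective_smul p.2 (ih p.1)
    · simpa [hv] using ih v

/-- Each letter is replaced by its value under a moved coordinate map, which is still injective and
so keeps it nontrivial; the rest of reducedness depends only on the vertices. -/
theorem exists_isReduced_cocycle {x : ∀ v, PointedMaps (H v) (G v)}
    (hx : ∀ v, Function.Injective (x v)) (w : List (Σ v, H v)) (hw : IsReduced Θ w) :
    ∃ w' : List (Σ v, G v), IsReduced Θ w' ∧ w'.map Sigma.fst = w.map Sigma.fst ∧
      wordProd Θ w' = cocycle (wordProd Θ w) x := by
  induction w with
  | nil => exact ⟨[], ⟨by simp, trivial⟩, rfl, by simp [cocycle_one]⟩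
  | cons p w ih =>
    obtain ⟨ha, he, hw⟩ := (isReduced_cons _ _).1 hw
    obtain ⟨w', hr, hs, hp⟩ := ih hw
    refine ⟨⟨p.1, base (wordProd Θ w) x p.1 p.2⟩ :: w', ?_, by simp [hs], ?_⟩
    · refine (isReduced_cons _ _).2 ⟨fun h => ha ?_, by rwa [hs], hr⟩
      exact injective_base _ hx p.1 (h.trans (base (wordProd Θ w) x p.1).2.symm)
    · rw [wordProd_cons, wordProd_cons, cocycle_mul, cocycle_of, hp]

theorem injective_toPointedMaps [Finite V] {x : ∀ v, PointedMaps (H v) (G v)}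
    (hx : ∀ v, Function.Injective (x v)) : Function.Injective (toPointedMaps Θ x) := by
  have := Fintype.ofFinite V
  have key : ∀ y : ∀ v, PointedMaps (H v) (G v), (∀ v, Function.Injective (y v)) →
      ∀ h : GraphProduct Θ H, cocycle h y = 1 → h = 1 := by
    intro y hy h hh
    obtain ⟨w, hw, rfl⟩ := exists_isReduced h
    obtain ⟨w', hr, hs, hp⟩ := exists_isReduced_cocycle hy w hw
    obtain rfl := eq_nil_of_wordProd_eq_one w' hr (hp.trans hh)
    rw [List.map_eq_nil_iff.1 hs.symm, wordProd_nil]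
  intro h k hhk
  -- Moving the base point by `k` reduces injectivity to triviality of the kernel for `h * k⁻¹`.
  rw [toPointedMaps_apply, toPointedMaps_apply, ← inv_mul_cancel_right h k, cocycle_mul] at hhk
  exact mul_inv_eq_one.1 (key _ (injective_base k hx) _ (mul_eq_right.1 hhk))

end Cocycle

end GraphProduct

namespace PointedMaps

/-! ### Measurability on spaces of pointed maps -/

section Measurability

variable {Λ Γ : Type*} [Group Λ] [Group Γ]

theorem measurable_apply (l : Λ) :
    @Measurable _ _ _ ⊤ (fun f : PointedMaps Λ Γ => f l) := by
  let : MeasurableSpace Γ := ⊤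
  exact (measurable_pi_apply l).comp 
    (comap_measurable fun (f : PointedMaps Λ Γ) (l : Λ) => f l)

theorem measurable_of_apply {X : Type*} [MeasurableSpace X] {F : X → PointedMaps Λ Γ}
    (hF : ∀ l, @Measurable _ _ _ ⊤ (fun x => F x l)) : Measurable F := by
  let : MeasurableSpace Γ := ⊤
  exact measurable_comap_iff.2 (measurable_pi_iff.2 hF)

theorem measurable_smul [Countable Γ] (l : Λ) :
    Measurable (fun f : PointedMaps Λ Γ => l • f) := by
  let : MeasurableSpace Γ := ⊤
  refine measurable_of_apply fun x => ?_
  -- Countability makes the product σ-algebra on `Γ × Γ` discrete.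
  have h : Measurable fun p : Γ × Γ => p.1 * p.2⁻¹ := Measurable.of_discrete
  exact h.comp ((measurable_apply (x * l)).prodMk (measurable_apply l))

theorem measurableSet_injective [Countable Λ] [Countable Γ] :
    MeasurableSet {f : PointedMaps Λ Γ | Function.Injective f} := by
  let : MeasurableSpace Γ := ⊤
  have h : {f : PointedMaps Λ Γ | Function.Injective f} =
      ⋂ (a : Λ) (b : Λ), {f | f a = f b → a = b} := by
    ext f
    simp [Function.Injective]
  rw [h]
  refine MeasurableSet.iInter fun a => MeasurableSet.iInter fun b => ?_
  exact (measurableSet_eq_fun (measurable_apply a) (measurable_apply b)).imp (.const _)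

end Measurability

end PointedMaps

namespace GraphProduct

/-! ### The product measure and its pushforward -/

section Measure

variable {V : Type*} {Θ : SimpleGraph V} {H G : V → Type*} [∀ v, Group (H v)]
  [∀ v, Group (G v)]

theorem measurePreserving_base [Fintype V] [∀ v, Countable (G v)]
    (μ : ∀ v, Measure (PointedMaps (H v) (G v))) (hμ : ∀ v, IsRandomorphism (μ v))
    (h : GraphProduct Θ H) :
    MeasurePreserving (base h) (Measure.pi μ) (Measure.pi μ) := by
  classical
  have := fun v => (hμ v).isProbabilityMeasure
  have := fun v => (hμ v).invariant
  obtain ⟨w, rfl⟩ := wordProd_surjective h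
  induction w with
  | nil =>
    convert MeasurePreserving.id (Measure.pi μ)
    exact funext base_one
  | cons p w ih =>
    rw [wordProd_cons, funext (base_mul _ _)]
    refine MeasurePreserving.comp (g := base (of Θ p.1 p.2)) ?_ ih
    -- A generator moves one coordinate only; written coordinatewise, it is a product of
    -- measure-preserving maps.
    have hf : ∀ v, MeasurePreserving
        (fun f => if hv : p.1 = v then (hv ▸ p.2) • f else f) (μ v) (μ v) := by
      intro v
      by_cases hv : p.1 = v
      · subst hv
        simp only [dif_pos]
        refine ⟨PointedMaps.measurable_smul p.2, Measure.ext fun s hs => ?_⟩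
        rw [Measure.map_apply (PointedMaps.measurable_smul p.2) hs]
        exact SMulInvariantMeasure.measure_preimage_smul p.2 hs
      · simp only [dif_neg hv]
        exact MeasurePreserving.id _
    convert measurePreserving_pi μ μ hf using 1
    funext x v
    rw [base_of]
    by_cases hv : p.1 = v
    · subst hv
      simp
    · simp [hv, Function.update_of_ne (Ne.symm hv)]

theorem measurable_cocycle [Fintype V] [∀ v, Countable (G v)]
    (μ : ∀ v, Measure (PointedMaps (H v) (G v))) (hμ : ∀ v, IsRandomorphism (μ v))
    (h : GraphProduct Θ H) :
    @Measurable _ _ _ ⊤ (fun x : ∀ v, PointedMaps (H v) (G v) => cocycle h x) := by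
  let : MeasurableSpace (GraphProduct Θ G) := ⊤
  obtain ⟨w, rfl⟩ := wordProd_surjective h
  induction w with
  | nil => simp [cocycle_one]
  | cons p w ih =>
    let : MeasurableSpace (G p.1) := ⊤
    have hm : Measurable fun q : G p.1 × GraphProduct Θ G => of Θ p.1 q.1 * q.2 :=
      Measurable.of_discrete
    have ha : Measurable fun x : ∀ v, PointedMaps (H v) (G v) =>
        base (wordProd Θ w) x p.1 p.2 :=
      (PointedMaps.measurable_apply p.2).comp ((measurable_pi_apply p.1).comp
        (measurePreserving_base μ hμ (wordProd Θ w)).measurable)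
    have hc := hm.comp (ha.prodMk ih)
    have heq : (fun x : ∀ v, PointedMaps (H v) (G v) => cocycle (wordProd Θ (p :: w)) x) =
        (fun q : G p.1 × GraphProduct Θ G => of Θ p.1 q.1 * q.2) ∘
          fun x => (base (wordProd Θ w) x p.1 p.2, cocycle (wordProd Θ w) x) := by
      funext x
      rw [wordProd_cons, cocycle_mul, cocycle_of, Function.comp_apply]
    rw [heq]
    exact hc

theorem measurable_toPointedMaps [Fintype V] [∀ v, Countable (G v)]
    (μ : ∀ v, Measure (PointedMaps (H v) (G v))) (hμ : ∀ v, IsRandomorphism (μ v)) :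
    Measurable (toPointedMaps Θ : (∀ v, PointedMaps (H v) (G v)) → _) :=
  PointedMaps.measurable_of_apply (F := toPointedMaps Θ) (measurable_cocycle μ hμ)

theorem isRandembedding_map [Fintype V] [∀ v, Countable (H v)] [∀ v, Countable (G v)]
    (μ : ∀ v, Measure (PointedMaps (H v) (G v))) (hμ : ∀ v, IsRandembedding (μ v)) :
    IsRandembedding ((Measure.pi μ).map (toPointedMaps Θ)) := by
  have hμ' := fun v => (hμ v).toIsRandomorphism
  have := fun v => (hμ' v).isProbabilityMeasure
  have hF := measurable_toPointedMaps (Θ := Θ) μ hμ'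
  refine ⟨⟨Measure.isProbabilityMeasure_map hF.aemeasurable, ⟨fun h s hs => ?_⟩⟩, ?_⟩
  · rw [Measure.map_apply hF (PointedMaps.measurable_smul h hs), Measure.map_apply hF hs]
    have hpre : toPointedMaps Θ ⁻¹' ((fun f => h • f) ⁻¹' s) =
        base h ⁻¹' (toPointedMaps (H := H) (G := G) Θ ⁻¹' s) := by
      ext x
      simp only [Set.mem_preimage, smul_toPointedMaps]
    rw [hpre]
    exact (measurePreserving_base μ hμ' h).measure_preimage (hF hs).nullMeasurableSet
  · rw [ae_map_iff hF.aemeasurable PointedMaps.measurableSet_injective]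
    have hx : ∀ᵐ x ∂Measure.pi μ, ∀ v, Function.Injective (x v) :=
      ae_all_iff.2 fun v => Measure.tendsto_eval_ae_ae.eventually (hμ v).injective
    exact hx.mono fun x hx => injective_toPointedMaps hx

end Measure

end GraphProduct

theorem mainTheorem9 {V : Type*} [Finite V] (Θ : SimpleGraph V)
    (H G : V → Type*) [∀ v, Group (H v)] [∀ v, Group (G v)]
    [∀ v, Nontrivial (H v)] [∀ v, Nontrivial (G v)]
    [∀ v, Group.FG (H v)] [∀ v, Group.FG (G v)]
    (h : ∀ v, IsRandomSubgroup (H v) (G v)) :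
    IsRandomSubgroup (GraphProduct Θ H) (GraphProduct Θ G) := by
  have := Fintype.ofFinite V
  have : ∀ v, Countable (H v) := fun v => Group.countable_of_fg _
  have : ∀ v, Countable (G v) := fun v => Group.countable_of_fg _
  choose μ hμ using h
  exact ⟨_, GraphProduct.isRandembedding_map μ hμ⟩
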